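/- **Conventions.** Composition is written in diagrammatic order. An $n$-precategory is an $n$-dimensional globular set with identities and, for a $k$-cell $u$ and an $l$-cell $v$, composites $u \ast_i v$, $i=\min(k,l)-1$, that are associative, unital, and distributive over higher compositions, without any interchange law (for $n=2$: a sesquicategory). A $4$-prepolygraph $\mathsf Q$ consists of sets $\mathsf Q_0,\dots,\mathsf Q_4$ of generators, where the elements of $\mathsf Q_{k+1}$ have parallel source and target in the set $\mathsf Q_k^*$ of $k$-cells of the free precategory on the generators of dimension $\le k$. Every $k$-cell is in a unique way a $(k-1)$-composite of whiskers ($k$-generators in a context of lower cells); the number of whiskers is its length. We write $\to,\Rightarrow,\Rrightarrow$ for $1$-, $2$- and $3$-cells, and $\mathsf Q_{\le 3}$ for the underlying $3$-prepolygraph. **Gray presentations.** A *Gray presentation* is a $4$-prepolygraph $\mathsf Q$ containing the following distinguished generators. 1. For $0$-composable $\alpha\colon f\Rightarrow f'$ in $\mathsf Q_2$, $g\in \mathsf Q_1^*$, $\beta\colon h\Rightarrow h'$ in $\mathsf Q_2$, a $3$-generator $$X_{\alpha,g,\beta}\colon (\alpha \ast_0 g\ast_0 h)\ast_1(f'\ast_0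 g\ast_0\beta)\Rrightarrow (f\ast_0 g\ast_0\beta)\ast_1(\alpha\ast_0 g\ast_0 h').$$ For $2$-cells $\phi=w_1\ast_1\cdots\ast_1 w_k\colon f\Rightarrow f'$ and $\psi=v_1\ast_1\cdots\ast_1 v_m\colon h\Rightarrow h'$ that are $0$-composable and decomposed into whiskers, let $$X_{\phi,\psi}\colon(\phi\ast_0 h)\ast_1(f'\ast_0\psi)\Rrightarrow(f\ast_0\psi)\ast_1(\phi\ast_0 h')$$ be the $3$-cell that moves $w_k$ past $v_1,\dots,v_m$ in this order, then $w_{k-1}$, and so on until $w_1$; here $w=l\ast_0\alpha\ast_0 r$ is moved past $v=l'\ast_0\beta\ast_0 r'$ by $l\ast_0X_{\alpha,\,r\ast_0 l',\,\beta}\ast_0 r'$ in the evident context. If $k,m\ge1$, its first step, which exchanges $w_k$ and $v_1$, is denoted $X^1_{\phi,\psi}$. 2. For $A\colon\phi\Rrightarrow\phi'$ and $B\colon\psi\Rrightarrow\psi'$ in $\mathsf Q_3$, with $\phi,\phi'\colon f\Rightarrow g$ and $\psi,\psi'\colon f'\Rightarrow g'$, for $1$-cells $e,h,e',h'$ and a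 $2$-cell $\chi\colon e\ast_0 g\ast_0 h\Rightarrow e'\ast_0 f'\ast_0 h'$, a $4$-generator from $$\big((e\ast_0A\ast_0h)\ast_1\chi\ast_1(e'\ast_0\psi\ast_0h')\big)\ast_2\big((e\ast_0\phi'\ast_0h)\ast_1\chi\ast_1(e'\ast_0B\ast_0h')\big)$$ to $$\big((e\ast_0\phi\ast_0h)\ast_1\chi\ast_1(e'\ast_0B\ast_0h')\big)\ast_2\big((e\ast_0A\ast_0h)\ast_1\chi\ast_1(e'\ast_0\psi'\ast_0h')\big).$$ 3. For $0$-composable $A\colon \phi\Rrightarrow\phi'$ in $\mathsf Q_3$ (with $\phi,\phi'\colon f\Rightarrow f'$), $g\in\mathsf Q_1^*$ and $\beta\colon h\Rightarrow h'$ in $\mathsf Q_2$, a $4$-generator from $$\big((A\ast_0 g\ast_0 h)\ast_1(f'\ast_0 g\ast_0\beta)\big)\ast_2 X_{\phi',g\ast_0\beta}\quad\text{to}\quad X_{\phi,g\ast_0\beta}\ast_2\big((f\ast_0 g\ast_0\beta)\ast_1(A\ast_0 g\ast_0 h')\big);$$ and, for $0$-composable $\alpha\colon f\Rightarrow f'$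 in $\mathsf Q_2$, $g\in\mathsf Q_1^*$ and $B\colon\psi\Rrightarrow\psi'$ in $\mathsf Q_3$ (with $\psi,\psi'\colon h\Rightarrow h'$), a $4$-generator from $$\big((\alpha\ast_0 g\ast_0 h)\ast_1(f'\ast_0 g\ast_0 B)\big)\ast_2 X_{\alpha\ast_0 g,\psi'}\quad\text{to}\quad X_{\alpha\ast_0 g,\psi}\ast_2\big((f\ast_0 g\ast_0 B)\ast_1(\alpha\ast_0 g\ast_0 h')\big).$$ **Rewriting.** A *rewriting step* is a $3$-cell $\lambda\ast_1(l\ast_0A\ast_0r)\ast_1\rho$ with $A\in\mathsf Q_3$, $l,r\in\mathsf Q_1^*$ and $\lambda,\rho\in\mathsf Q_2^*$. $\mathsf Q_{\le3}$ is *terminating* if there is no infinite sequence of rewriting steps $\phi_0\Rrightarrow\phi_1\Rrightarrow\phi_2\Rrightarrow\cdots$. A *local branching* is a pair $(S_1,S_2)$ of rewriting steps with the same source. It is - *trivial* if $S_1=S_2$; - *minimal* if, whenever $S_i=\lambda\ast_1(l\ast_0S_i'\ast_0r)\ast_1\rho$ ($i=1,2$) for a local branching $(S_1',S_2')$, the cells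 $l,r,\lambda,\rho$ are identities; - *independent* if $S_1=(l_1\ast_0A_1\ast_0r_1)\ast_1\chi\ast_1(l_2\ast_0\phi_2\ast_0r_2)$ and $S_2=(l_1\ast_0\phi_1\ast_0r_1)\ast_1\chi\ast_1(l_2\ast_0A_2\ast_0r_2)$ for some $A_i\colon\phi_i\Rrightarrow\phi_i'$ in $\mathsf Q_3$, $1$-cells $l_i,r_i$ and a $2$-cell $\chi$; - *natural* if either $S_1=(A\ast_0g\ast_0h)\ast_1(f'\ast_0g\ast_0\psi)$ and $S_2=X^1_{\phi,\,g\ast_0\psi}$ for some $A\colon\phi\Rrightarrow\phi'$ in $\mathsf Q_3$ with $\phi\colon f\Rightarrow f'$, some $1$-cell $g$ and some $2$-cell $\psi\colon h\Rightarrow h'$; or $S_1=(\phi\ast_0g\ast_0h)\ast_1(f'\ast_0g\ast_0B)$ and $S_2=X^1_{\phi\ast_0g,\,\psi}$ for some $2$-cell $\phi\colon f\Rightarrow f'$, some $1$-cell $g$ and some $B\colon\psi\Rrightarrow\psi'$ in $\mathsf Q_3$ with $\psi\colon h\Rightarrow h'$; - *critical* if it is minimal and neither $(S_1,S_2)$ nor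 $(S_2,S_1)$ is trivial, independent or natural. **Coherence.** Let $\overline{\mathsf Q}$ be the $3$-precategory obtained from the free $3$-precategory on $\mathsf Q_{\le3}$ by quotienting its $3$-cells by the smallest congruence that identifies the source and the target of each element of $\mathsf Q_4$. The Gray presentation $\mathsf Q$ is *coherent* if any two parallel $3$-cells are equal in the localization of $\overline{\mathsf Q}$ at all its $3$-cells. **Theorem.** Let $\mathsf Q$ be a Gray presentation such that $\mathsf Q_{\le3}$ is terminating and such that, for every critical branching $(S_1\colon\phi\Rrightarrow\phi_1,\ S_2\colon\phi\Rrightarrow\phi_2)$, there are a $2$-cell $\psi\in\mathsf Q_2^*$, $3$-cells $F_i\colon\phi_i\Rrightarrow\psi$ in $\mathsf Q_3^*$ ($i=1,2$), and a $4$-generator $S_1\ast_2F_1\to S_2\ast_2F_2$ in $\mathsf Q_4$. Then $\mathsf Q$ is coherent. -/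

import Mathlib

/-! Prepolygraphs up to dimension four, the free precategories they generate, Gray presentations,
their rewriting theory, and coherence.

Composition of cells is always written in diagrammatic order. In dimension `k`, a cell of the
free precategory is a formal composite (a path) of `k`-dimensional whiskers, that is, of
`k`-generators placed in a context of cells of lower dimension. -/

universe u

open CategoryTheory

namespace GrayRewriting

/-! ### Dimensions zero and one -/

/-- A `1`-prepolygraph: a set of `0`-generators, and `1`-generators with given source and target. -/
structure Prepolygraph1 where
  gen0 : Type u
  gen1 : gen0 → gen0 → Type u

instance (P : Prepolygraph1.{u}) : Quiver.{u} P.gen0 := ⟨P.gen1⟩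

/-- The `1`-cells freely generated by a `1`-prepolygraph: paths of `1`-generators. Their
`0`-composition is `Quiver.Path.comp`. -/
abbrev Prepolygraph1.Cell1 (P : Prepolygraph1.{u}) (x y : P.gen0) : Type u := Quiver.Path x y

/-! ### Dimension two -/

/-- A `2`-prepolygraph: `2`-generators between parallel `1`-cells are added. -/
structure Prepolygraph2 extends Prepolygraph1.{u} where
  gen2 : ∀ {x y : gen0}, toPrepolygraph1.Cell1 x y → toPrepolygraph1.Cell1 x y → Type u

/-- A `2`-dimensional whisker `left ∘₀ gen ∘₀ right`. -/
@[ext]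
structure Whisker2 (P : Prepolygraph2.{u}) (x y : P.gen0) where
  {a : P.gen0}
  {b : P.gen0}
  {s : P.Cell1 a b}
  {t : P.Cell1 a b}
  left : P.Cell1 x a
  gen : P.gen2 s t
  right : P.Cell1 b y

namespace Whisker2

variable {P : Prepolygraph2.{u}} {x y z : P.gen0}

/-- The source of a whisker. -/
def src (w : Whisker2 P x y) : P.Cell1 x y := w.left.comp (w.s.comp w.right)

/-- The target of a whisker. -/
def tgt (w : Whisker2 P x y) : P.Cell1 x y := w.left.comp (w.t.comp w.right)

/-- `l ∘₀ w`. -/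
def whiskerLeft (l : P.Cell1 z x) (w : Whisker2 P x y) : Whisker2 P z y :=
  ⟨l.comp w.left, w.gen, w.right⟩

/-- `w ∘₀ r`. -/
def whiskerRight (w : Whisker2 P x y) (r : P.Cell1 y z) : Whisker2 P x z :=
  ⟨w.left, w.gen, w.right.comp r⟩

theorem src_whiskerLeft (l : P.Cell1 z x) (w : Whisker2 P x y) :
    (w.whiskerLeft l).src = l.comp w.src := by simp [src, whiskerLeft]

theorem tgt_whiskerLeft (l : P.Cell1 z x) (w : Whisker2 P x y) :
    (w.whiskerLeft l).tgt = l.comp w.tgt := by simp [tgt, whiskerLeft]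

theorem src_whiskerRight (w : Whisker2 P x y) (r : P.Cell1 y z) :
    (w.whiskerRight r).src = w.src.comp r := by simp [src, whiskerRight]

theorem tgt_whiskerRight (w : Whisker2 P x y) (r : P.Cell1 y z) :
    (w.whiskerRight r).tgt = w.tgt.comp r := by simp [tgt, whiskerRight]

end Whisker2

/-- The arrows `f ⟶ g` between parallel `1`-cells are the whiskers of source `f` and target `g`. -/
instance (P : Prepolygraph2.{u}) (x y : P.gen0) : Quiver.{u} (P.Cell1 x y) :=
  ⟨fun f g => {w : Whisker2 P x y // w.src = f ∧ w.tgt = g}⟩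

/-- The `2`-cells `f ⇒ g` of the free `2`-precategory: `1`-composable sequences of whiskers. Their
`1`-composition is `Quiver.Path.comp`, and identities are `Quiver.Path.nil`. -/
abbrev Prepolygraph2.Cell2 (P : Prepolygraph2.{u}) {x y : P.gen0} (f g : P.Cell1 x y) : Type u :=
  Quiver.Path f g

namespace Prepolygraph2

variable {P : Prepolygraph2.{u}} {x y z w : P.gen0}

/-- The `2`-cell consisting of a single generator. -/
def ofGen2 {f g : P.Cell1 x y} (α : P.gen2 f g) : P.Cell2 f g :=
  Quiver.Hom.toPath (a := f) (b := g)
    ⟨⟨Quiver.Path.nil, α, Quiver.Path.nil⟩, by simp [Whisker2.src], by simp [Whisker2.tgt]⟩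

/-- `l ∘₀ e` for a single whisker `e`. -/
def edgeLeft (l : P.Cell1 z x) {f g : P.Cell1 x y} (e : f ⟶ g) : l.comp f ⟶ l.comp g :=
  ⟨e.1.whiskerLeft l, by rw [Whisker2.src_whiskerLeft, e.2.1],
    by rw [Whisker2.tgt_whiskerLeft, e.2.2]⟩

/-- `e ∘₀ r` for a single whisker `e`. -/
def edgeRight {f g : P.Cell1 x y} (e : f ⟶ g) (r : P.Cell1 y z) : f.comp r ⟶ g.comp r :=
  ⟨e.1.whiskerRight r, by rw [Whisker2.src_whiskerRight, e.2.1],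
    by rw [Whisker2.tgt_whiskerRight, e.2.2]⟩

/-- The `0`-composite `l ∘₀ φ` of a `1`-cell and a `2`-cell. -/
def whiskerLeft (l : P.Cell1 z x) {f : P.Cell1 x y} :
    ∀ {g : P.Cell1 x y}, P.Cell2 f g → P.Cell2 (l.comp f) (l.comp g)
  | _, Quiver.Path.nil => Quiver.Path.nil
  | _, Quiver.Path.cons φ e => (whiskerLeft l φ).cons (edgeLeft l e)

/-- The `0`-composite `φ ∘₀ r` of a `2`-cell and a `1`-cell. -/
def whiskerRight {f : P.Cell1 x y} :
    ∀ {g : P.Cell1 x y}, P.Cell2 f g → ∀ r : P.Cell1 y z, P.Cell2 (f.comp r) (g.comp r)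
  | _, Quiver.Path.nil, _ => Quiver.Path.nil
  | _, Quiver.Path.cons φ e, r => (whiskerRight φ r).cons (edgeRight e r)

/-- The list of whiskers of a `2`-cell. -/
def whiskers {f : P.Cell1 x y} : ∀ {g : P.Cell1 x y}, P.Cell2 f g → List (Whisker2 P x y)
  | _, Quiver.Path.nil => []
  | _, Quiver.Path.cons φ e => whiskers φ ++ [e.1]

theorem whiskers_injective {f g : P.Cell1 x y} {φ ψ : P.Cell2 f g}
    (h : whiskers φ = whiskers ψ) : φ = ψ := by
  induction φ with
  | nil =>
    generalize hg : f = g' at ψ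
    cases ψ with
    | nil => cases hg; rfl
    | cons ψ e => simp [whiskers] at h
  | @cons b c φ e ih =>
    cases ψ with
    | nil => simp [whiskers] at h
    | @cons b' _ ψ e' =>
      have h1 : e.1 = e'.1 ∧ whiskers φ = whiskers ψ := by
        simpa [whiskers] using congrArg List.reverse h
      have hb : b = b' := by rw [← e.2.1, ← e'.2.1, h1.1]
      subst hb
      rw [ih h1.2, Subtype.ext h1.1]

theorem whiskers_comp {f g h : P.Cell1 x y} (φ : P.Cell2 f g) (ψ : P.Cell2 g h) :
    whiskers (φ.comp ψ) = whiskers φ ++ whiskers ψ := by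
  induction ψ with
  | nil => simp [whiskers]
  | cons ψ e ih => simp [whiskers, ih]

theorem whiskers_cast {f g f' g' : P.Cell1 x y} (hf : f = f') (hg : g = g') (φ : P.Cell2 f g) :
    whiskers (φ.cast hf hg) = whiskers φ := by
  subst hf hg; rfl

theorem whiskers_whiskerLeft (l : P.Cell1 z x) {f g : P.Cell1 x y} (φ : P.Cell2 f g) :
    whiskers (whiskerLeft l φ) = (whiskers φ).map (Whisker2.whiskerLeft l) := by
  induction φ with
  | nil => rfl
  | cons φ e ih => simp [whiskers, whiskerLeft, ih, edgeLeft]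

theorem whiskers_whiskerRight {f g : P.Cell1 x y} (φ : P.Cell2 f g) (r : P.Cell1 y z) :
    whiskers (whiskerRight φ r) = (whiskers φ).map (fun w => w.whiskerRight r) := by
  induction φ with
  | nil => rfl
  | cons φ e ih => simp [whiskers, whiskerRight, ih, edgeRight]

end Prepolygraph2

/-! ### Dimension three -/

/-- A `3`-prepolygraph: `3`-generators between parallel `2`-cells are added. -/
structure Prepolygraph3 extends Prepolygraph2.{u} where
  gen3 : ∀ {x y : gen0} {f g : toPrepolygraph2.Cell1 x y},
    toPrepolygraph2.Cell2 f g → toPrepolygraph2.Cell2 f g → Type u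

open Prepolygraph2

/-- A rewriting step `before ∘₁ (left ∘₀ gen ∘₀ right) ∘₁ after`, that is, a `3`-dimensional
whisker, between two (not displayed) `2`-cells `f ⇒ g`. -/
structure RewritingStep (P : Prepolygraph3.{u}) {x y : P.gen0} (f g : P.Cell1 x y) where
  {a : P.gen0}
  {b : P.gen0}
  {s : P.Cell1 a b}
  {t : P.Cell1 a b}
  {σ : P.Cell2 s t}
  {τ : P.Cell2 s t}
  gen : P.gen3 σ τ
  left : P.Cell1 x a
  right : P.Cell1 b y
  before : P.Cell2 f (left.comp (s.comp right))
  after : P.Cell2 (left.comp (t.comp right)) g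

namespace RewritingStep

variable {P : Prepolygraph3.{u}} {x y z : P.gen0} {f g : P.Cell1 x y}

/-- The source of a rewriting step. -/
def src (S : RewritingStep P f g) : P.Cell2 f g :=
  S.before.comp ((P.whiskerLeft S.left (P.whiskerRight S.σ S.right)).comp S.after)

/-- The target of a rewriting step. -/
def tgt (S : RewritingStep P f g) : P.Cell2 f g :=
  S.before.comp ((P.whiskerLeft S.left (P.whiskerRight S.τ S.right)).comp S.after)

/-- `l ∘₀ S`. -/
def whiskerLeft (l : P.Cell1 z x) (S : RewritingStep P f g) :
    RewritingStep P (l.comp f) (l.comp g) where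
  gen := S.gen
  left := l.comp S.left
  right := S.right
  before := (P.whiskerLeft l S.before).cast rfl (by simp)
  after := (P.whiskerLeft l S.after).cast (by simp) rfl

/-- `S ∘₀ r`. -/
def whiskerRight (S : RewritingStep P f g) (r : P.Cell1 y z) :
    RewritingStep P (f.comp r) (g.comp r) where
  gen := S.gen
  left := S.left
  right := S.right.comp r
  before := (P.whiskerRight S.before r).cast rfl (by simp)
  after := (P.whiskerRight S.after r).cast (by simp) rfl

/-- `lam ∘₁ S`. -/
def precomp {e : P.Cell1 x y} (lam : P.Cell2 e f) (S : RewritingStep P f g) :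
    RewritingStep P e g where
  gen := S.gen
  left := S.left
  right := S.right
  before := lam.comp S.before
  after := S.after

/-- `S ∘₁ rho`. -/
def postcomp (S : RewritingStep P f g) {h : P.Cell1 x y} (rho : P.Cell2 g h) :
    RewritingStep P f h where
  gen := S.gen
  left := S.left
  right := S.right
  before := S.before
  after := S.after.comp rho

theorem src_whiskerLeft (l : P.Cell1 z x) (S : RewritingStep P f g) :
    (S.whiskerLeft l).src = P.whiskerLeft l S.src := by
  apply whiskers_injective
  simp [src, whiskerLeft, whiskers_comp, whiskers_cast, whiskers_whiskerLeft,
    whiskers_whiskerRight, Whisker2.whiskerLeft, Whisker2.whiskerRight]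

theorem tgt_whiskerLeft (l : P.Cell1 z x) (S : RewritingStep P f g) :
    (S.whiskerLeft l).tgt = P.whiskerLeft l S.tgt := by
  apply whiskers_injective
  simp [tgt, whiskerLeft, whiskers_comp, whiskers_cast, whiskers_whiskerLeft,
    whiskers_whiskerRight, Whisker2.whiskerLeft, Whisker2.whiskerRight]

theorem src_whiskerRight (S : RewritingStep P f g) (r : P.Cell1 y z) :
    (S.whiskerRight r).src = P.whiskerRight S.src r := by
  apply whiskers_injective
  simp [src, whiskerRight, whiskers_comp, whiskers_cast, whiskers_whiskerLeft,
    whiskers_whiskerRight, Whisker2.whiskerLeft, Whisker2.whiskerRight]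

theorem tgt_whiskerRight (S : RewritingStep P f g) (r : P.Cell1 y z) :
    (S.whiskerRight r).tgt = P.whiskerRight S.tgt r := by
  apply whiskers_injective
  simp [tgt, whiskerRight, whiskers_comp, whiskers_cast, whiskers_whiskerLeft,
    whiskers_whiskerRight, Whisker2.whiskerLeft, Whisker2.whiskerRight]

theorem src_precomp {e : P.Cell1 x y} (lam : P.Cell2 e f) (S : RewritingStep P f g) :
    (S.precomp lam).src = lam.comp S.src := by simp [src, precomp]

theorem tgt_precomp {e : P.Cell1 x y} (lam : P.Cell2 e f) (S : RewritingStep P f g) :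
    (S.precomp lam).tgt = lam.comp S.tgt := by simp [tgt, precomp]

theorem src_postcomp (S : RewritingStep P f g) {h : P.Cell1 x y} (rho : P.Cell2 g h) :
    (S.postcomp rho).src = S.src.comp rho := by simp [src, postcomp]

theorem tgt_postcomp (S : RewritingStep P f g) {h : P.Cell1 x y} (rho : P.Cell2 g h) :
    (S.postcomp rho).tgt = S.tgt.comp rho := by simp [tgt, postcomp]

end RewritingStep

/-- The arrows `φ ⟶ ψ` between parallel `2`-cells are the rewriting steps of source `φ` and
target `ψ`. -/
instance (P : Prepolygraph3.{u}) {x y : P.gen0} (f g : P.Cell1 x y) : Quiver.{u} (P.Cell2 f g) :=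
  ⟨fun φ ψ => {S : RewritingStep P f g // S.src = φ ∧ S.tgt = ψ}⟩

/-- The `3`-cells `φ ⇛ ψ` of the free `3`-precategory, also called rewriting paths:
`2`-composable sequences of rewriting steps. Their `2`-composition is `Quiver.Path.comp`, and
identities are `Quiver.Path.nil`. -/
abbrev Prepolygraph3.Cell3 (P : Prepolygraph3.{u}) {x y : P.gen0} {f g : P.Cell1 x y}
    (φ ψ : P.Cell2 f g) : Type u :=
  Quiver.Path φ ψ

namespace RewritingStep

variable {P : Prepolygraph3.{u}} {x y : P.gen0} {f g : P.Cell1 x y}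

/-- A rewriting step, as a `3`-cell between its source and its target. -/
def toCell3 (S : RewritingStep P f g) : P.Cell3 S.src S.tgt :=
  Quiver.Hom.toPath (a := S.src) (b := S.tgt) ⟨S, rfl, rfl⟩

end RewritingStep

namespace Prepolygraph3

variable {P : Prepolygraph3.{u}} {x y z : P.gen0} {f g : P.Cell1 x y}

theorem unit_context (f : P.Cell1 x y) :
    f = Quiver.Path.nil.comp (f.comp Quiver.Path.nil) := by simp

/-- The rewriting step consisting of a single generator in an empty context. -/
def stepOfGen3 {φ ψ : P.Cell2 f g} (A : P.gen3 φ ψ) : RewritingStep P f g where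
  gen := A
  left := Quiver.Path.nil
  right := Quiver.Path.nil
  before := Quiver.Path.nil.cast rfl (unit_context f)
  after := Quiver.Path.nil.cast (unit_context g) rfl

theorem whiskers_unit_context (φ : P.Cell2 f g) :
    (P.whiskers (P.whiskerLeft Quiver.Path.nil (P.whiskerRight φ Quiver.Path.nil))) =
      P.whiskers φ := by
  rw [whiskers_whiskerLeft, whiskers_whiskerRight, List.map_map]
  refine (List.map_congr_left fun w _ => ?_).trans (List.map_id _)
  simp [Whisker2.whiskerLeft, Whisker2.whiskerRight]

theorem src_stepOfGen3 {φ ψ : P.Cell2 f g} (A : P.gen3 φ ψ) : (stepOfGen3 A).src = φ := by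
  apply whiskers_injective
  rw [RewritingStep.src, whiskers_comp, whiskers_comp]
  simp only [stepOfGen3]
  rw [whiskers_cast, whiskers_unit_context, whiskers_cast]
  simp [whiskers]

theorem tgt_stepOfGen3 {φ ψ : P.Cell2 f g} (A : P.gen3 φ ψ) : (stepOfGen3 A).tgt = ψ := by
  apply whiskers_injective
  rw [RewritingStep.tgt, whiskers_comp, whiskers_comp]
  simp only [stepOfGen3]
  rw [whiskers_cast, whiskers_unit_context, whiskers_cast]
  simp [whiskers]

/-- The `3`-cell consisting of a single generator. -/
def ofGen3 {φ ψ : P.Cell2 f g} (A : P.gen3 φ ψ) : P.Cell3 φ ψ :=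
  Quiver.Hom.toPath (a := φ) (b := ψ) ⟨stepOfGen3 A, src_stepOfGen3 A, tgt_stepOfGen3 A⟩

/-- The `0`-composite `l ∘₀ F` of a `1`-cell and a `3`-cell. -/
def whiskerLeft3 (l : P.Cell1 z x) {φ : P.Cell2 f g} :
    ∀ {ψ : P.Cell2 f g}, P.Cell3 φ ψ → P.Cell3 (P.whiskerLeft l φ) (P.whiskerLeft l ψ)
  | _, Quiver.Path.nil => Quiver.Path.nil
  | _, Quiver.Path.cons F S => (whiskerLeft3 l F).cons
      ⟨S.1.whiskerLeft l, by rw [RewritingStep.src_whiskerLeft, S.2.1],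
        by rw [RewritingStep.tgt_whiskerLeft, S.2.2]⟩

/-- The `0`-composite `F ∘₀ r` of a `3`-cell and a `1`-cell. -/
def whiskerRight3 {φ : P.Cell2 f g} :
    ∀ {ψ : P.Cell2 f g}, P.Cell3 φ ψ → ∀ r : P.Cell1 y z,
      P.Cell3 (P.whiskerRight φ r) (P.whiskerRight ψ r)
  | _, Quiver.Path.nil, _ => Quiver.Path.nil
  | _, Quiver.Path.cons F S, r => (whiskerRight3 F r).cons
      ⟨S.1.whiskerRight r, by rw [RewritingStep.src_whiskerRight, S.2.1],
        by rw [RewritingStep.tgt_whiskerRight, S.2.2]⟩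

/-- The `1`-composite `lam ∘₁ F` of a `2`-cell and a `3`-cell. -/
def precomp3 {e : P.Cell1 x y} (lam : P.Cell2 e f) {φ : P.Cell2 f g} :
    ∀ {ψ : P.Cell2 f g}, P.Cell3 φ ψ → P.Cell3 (lam.comp φ) (lam.comp ψ)
  | _, Quiver.Path.nil => Quiver.Path.nil
  | _, Quiver.Path.cons F S => (precomp3 lam F).cons
      ⟨S.1.precomp lam, by rw [RewritingStep.src_precomp, S.2.1],
        by rw [RewritingStep.tgt_precomp, S.2.2]⟩

/-- The `1`-composite `F ∘₁ rho` of a `3`-cell and a `2`-cell. -/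
def postcomp3 {φ : P.Cell2 f g} :
    ∀ {ψ : P.Cell2 f g}, P.Cell3 φ ψ → ∀ {h : P.Cell1 x y} (rho : P.Cell2 g h),
      P.Cell3 (φ.comp rho) (ψ.comp rho)
  | _, Quiver.Path.nil, _, _ => Quiver.Path.nil
  | _, Quiver.Path.cons F S, _, rho => (postcomp3 F rho).cons
      ⟨S.1.postcomp rho, by rw [RewritingStep.src_postcomp, S.2.1],
        by rw [RewritingStep.tgt_postcomp, S.2.2]⟩

/-- There is no infinite sequence of composable rewriting steps. -/
def Terminating (P : Prepolygraph3.{u}) : Prop :=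
  ∀ {x y : P.gen0} {f g : P.Cell1 x y} (S : ℕ → RewritingStep P f g),
    ¬ ∀ n, (S n).tgt = (S (n + 1)).src

end Prepolygraph3

/-! ### Dimension four and Gray presentations -/

/-- A `4`-prepolygraph: `4`-generators between parallel `3`-cells are added. -/
structure Prepolygraph4 extends Prepolygraph3.{u} where
  gen4 : ∀ {x y : gen0} {f g : toPrepolygraph3.Cell1 x y} {φ ψ : toPrepolygraph3.Cell2 f g},
    toPrepolygraph3.Cell3 φ ψ → toPrepolygraph3.Cell3 φ ψ → Type u

open Prepolygraph3

/-- A choice of interchange generators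
`X α g β : (α ∘₀ g ∘₀ h) ∘₁ (f' ∘₀ g ∘₀ β) ⇛ (f ∘₀ g ∘₀ β) ∘₁ (α ∘₀ g ∘₀ h')`
for all `0`-composable `2`-generators `α : f ⇒ f'`, `1`-cells `g`, and `2`-generators
`β : h ⇒ h'`. -/
structure InterchangeGenerators (P : Prepolygraph3.{u}) where
  X : ∀ {x x' y' y : P.gen0} {f f' : P.Cell1 x x'} {h h' : P.Cell1 y' y}
    (α : P.gen2 f f') (g : P.Cell1 x' y') (β : P.gen2 h h'),
    P.gen3
      ((P.whiskerRight (P.ofGen2 α) (g.comp h)).comp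
        (P.whiskerLeft f' (P.whiskerLeft g (P.ofGen2 β))))
      ((P.whiskerLeft f (P.whiskerLeft g (P.ofGen2 β))).comp
        (P.whiskerRight (P.ofGen2 α) (g.comp h')))


section Interchange

variable {P : Prepolygraph3.{u}} (I : InterchangeGenerators P) {x y z : P.gen0}

theorem exchange_context {f f' : P.Cell1 x y} {h h' : P.Cell1 y z} (w : f ⟶ f') (v : h ⟶ h') :
    f.comp h = w.1.left.comp
      ((w.1.s.comp ((w.1.right.comp v.1.left).comp v.1.s)).comp v.1.right) := by
  obtain ⟨w, rfl, rfl⟩ := w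
  obtain ⟨v, rfl, rfl⟩ := v
  simp [Whisker2.src]

theorem exchange_context' {f f' : P.Cell1 x y} {h h' : P.Cell1 y z} (w : f ⟶ f') (v : h ⟶ h') :
    f'.comp h' = w.1.left.comp
      ((w.1.t.comp ((w.1.right.comp v.1.left).comp v.1.t)).comp v.1.right) := by
  obtain ⟨w, rfl, rfl⟩ := w
  obtain ⟨v, rfl, rfl⟩ := v
  simp [Whisker2.tgt]

/-- For whiskers `w = l ∘₀ α ∘₀ r : f ⇒ f'` and `v = l' ∘₀ β ∘₀ r' : h ⇒ h'`, the rewriting step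
`l ∘₀ X α (r ∘₀ l') β ∘₀ r' : (w ∘₀ h) ∘₁ (f' ∘₀ v) ⇛ (f ∘₀ v) ∘₁ (w ∘₀ h')`. -/
def InterchangeGenerators.exchange {f f' : P.Cell1 x y} {h h' : P.Cell1 y z}
    (w : f ⟶ f') (v : h ⟶ h') : RewritingStep P (f.comp h) (f'.comp h') where
  gen := I.X w.1.gen (w.1.right.comp v.1.left) v.1.gen
  left := w.1.left
  right := v.1.right
  before := Quiver.Path.nil.cast rfl (exchange_context w v)
  after := Quiver.Path.nil.cast (exchange_context' w v) rfl

theorem InterchangeGenerators.src_exchange {f f' : P.Cell1 x y} {h h' : P.Cell1 y z}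
    (w : f ⟶ f') (v : h ⟶ h') :
    (I.exchange w v).src = (P.whiskerRight w.toPath h).comp (P.whiskerLeft f' v.toPath) := by
  apply whiskers_injective
  rw [RewritingStep.src, whiskers_comp, whiskers_comp]
  simp only [InterchangeGenerators.exchange]
  rw [whiskers_cast, whiskers_cast]
  obtain ⟨w, rfl, rfl⟩ := w
  obtain ⟨v, rfl, rfl⟩ := v
  simp [whiskers_comp, whiskers_whiskerLeft, whiskers_whiskerRight, whiskers, ofGen2,
    Quiver.Hom.toPath, Whisker2.whiskerLeft, Whisker2.whiskerRight, Whisker2.src, Whisker2.tgt]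

theorem InterchangeGenerators.tgt_exchange {f f' : P.Cell1 x y} {h h' : P.Cell1 y z}
    (w : f ⟶ f') (v : h ⟶ h') :
    (I.exchange w v).tgt = (P.whiskerLeft f v.toPath).comp (P.whiskerRight w.toPath h') := by
  apply whiskers_injective
  rw [RewritingStep.tgt, whiskers_comp, whiskers_comp]
  simp only [InterchangeGenerators.exchange]
  rw [whiskers_cast, whiskers_cast]
  obtain ⟨w, rfl, rfl⟩ := w
  obtain ⟨v, rfl, rfl⟩ := v
  simp [whiskers_comp, whiskers_whiskerLeft, whiskers_whiskerRight, whiskers, ofGen2,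
    Quiver.Hom.toPath, Whisker2.whiskerLeft, Whisker2.whiskerRight, Whisker2.src, Whisker2.tgt]

/-- The `3`-cell `X_{w,ψ}` moving a whisker `w` past the whiskers `v₁, …, vₖ` of `ψ`, one after
the other and beginning with `v₁`. -/
def InterchangeGenerators.interchangeWhisker {f f' : P.Cell1 x y} (w : f ⟶ f') {h : P.Cell1 y z} :
    ∀ {h' : P.Cell1 y z} (ψ : P.Cell2 h h'),
      P.Cell3 ((P.whiskerRight w.toPath h).comp (P.whiskerLeft f' ψ))
        ((P.whiskerLeft f ψ).comp (P.whiskerRight w.toPath h'))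
  | _, Quiver.Path.nil => Quiver.Path.nil.cast rfl (Quiver.Path.nil_comp _).symm
  | _, Quiver.Path.cons ψ v =>
    (P.postcomp3 (interchangeWhisker w ψ) (P.whiskerLeft f' v.toPath)).comp
      (P.precomp3 (P.whiskerLeft f ψ)
        (Quiver.Hom.toPath ⟨I.exchange w v, I.src_exchange w v, I.tgt_exchange w v⟩))

/-- The `3`-cell `X_{φ,ψ} : (φ ∘₀ h) ∘₁ (f' ∘₀ ψ) ⇛ (f ∘₀ ψ) ∘₁ (φ ∘₀ h')` for `0`-composable
`2`-cells `φ = w₁ ∘₁ ⋯ ∘₁ wₖ : f ⇒ f'` and `ψ = v₁ ∘₁ ⋯ ∘₁ vₘ : h ⇒ h'`: the last whisker `wₖ` is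
moved past `v₁, …, vₘ`, then `wₖ₋₁` is, and so on until `w₁`. -/
def InterchangeGenerators.interchange {f : P.Cell1 x y} :
    ∀ {f' : P.Cell1 x y} (φ : P.Cell2 f f') {h h' : P.Cell1 y z} (ψ : P.Cell2 h h'),
      P.Cell3 ((P.whiskerRight φ h).comp (P.whiskerLeft f' ψ))
        ((P.whiskerLeft f ψ).comp (P.whiskerRight φ h'))
  | _, Quiver.Path.nil, _, _, _ => Quiver.Path.nil.cast (Quiver.Path.nil_comp _).symm rfl
  | _, Quiver.Path.cons φ w, h, h', ψ =>
    ((P.precomp3 (P.whiskerRight φ h) (I.interchangeWhisker w ψ)).cast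
      (Quiver.Path.comp_assoc _ _ _).symm (Quiver.Path.comp_assoc _ _ _).symm).comp
      (P.postcomp3 (interchange φ ψ) (P.whiskerRight w.toPath h'))

end Interchange

/-- The distinguished generators that make a `4`-prepolygraph a Gray presentation: interchange
generators, independence generators, and interchange naturality generators. -/
structure GrayGenerators (P : Prepolygraph4.{u}) where
  interchangers : InterchangeGenerators P.toPrepolygraph3
  /-- For `A : φ ⇛ φ'` with `φ, φ' : f ⇒ g` and `B : ψ ⇛ ψ'` with `ψ, ψ' : f' ⇒ g'`, and for
  `χ : e ∘₀ g ∘₀ h ⇒ e' ∘₀ f' ∘₀ h'`, a generator relating the two ways of applying `A` and `B`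
  in `(e ∘₀ φ ∘₀ h) ∘₁ χ ∘₁ (e' ∘₀ ψ ∘₀ h')`. -/
  independence : ∀ {w x y x' y' z : P.gen0}
    {f g : P.Cell1 x y} {φ φ' : P.Cell2 f g} (A : P.gen3 φ φ')
    {f' g' : P.Cell1 x' y'} {ψ ψ' : P.Cell2 f' g'} (B : P.gen3 ψ ψ')
    (e : P.Cell1 w x) (h : P.Cell1 y z)
    (e' : P.Cell1 w x') (h' : P.Cell1 y' z)
    (χ : P.Cell2 (e.comp (g.comp h)) (e'.comp (f'.comp h'))),
    P.gen4
      ((P.postcomp3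
          (P.whiskerLeft3 e (P.whiskerRight3 (ofGen3 A) h))
          (χ.comp (P.whiskerLeft e' (P.whiskerRight ψ h')))).comp
        (P.precomp3
          (P.whiskerLeft e (P.whiskerRight φ' h))
          (P.precomp3 χ
            (P.whiskerLeft3 e' (P.whiskerRight3 (ofGen3 B) h')))))
      ((P.precomp3
          (P.whiskerLeft e (P.whiskerRight φ h))
          (P.precomp3 χ
            (P.whiskerLeft3 e' (P.whiskerRight3 (ofGen3 B) h')))).comp
        (P.postcomp3
          (P.whiskerLeft3 e (P.whiskerRight3 (ofGen3 A) h))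
          (χ.comp (P.whiskerLeft e' (P.whiskerRight ψ' h')))))
  /-- For `A : φ ⇛ φ'` with `φ, φ' : f ⇒ f'` and `β : h ⇒ h'`, a generator
  `((A ∘₀ g ∘₀ h) ∘₁ (f' ∘₀ g ∘₀ β)) ∘₂ X_{φ', g ∘₀ β}
    ⟶ X_{φ, g ∘₀ β} ∘₂ ((f ∘₀ g ∘₀ β) ∘₁ (A ∘₀ g ∘₀ h'))`. -/
  naturalityLeft : ∀ {x x' y' y : P.gen0}
    {f f' : P.Cell1 x x'} {φ φ' : P.Cell2 f f'} (A : P.gen3 φ φ')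
    (g : P.Cell1 x' y') {h h' : P.Cell1 y' y} (β : P.gen2 h h'),
    P.gen4
      ((P.postcomp3 (P.whiskerRight3 (ofGen3 A) (g.comp h))
          (P.whiskerLeft f' (P.whiskerLeft g (ofGen2 β)))).comp
        (interchangers.interchange φ' (P.whiskerLeft g (ofGen2 β))))
      ((interchangers.interchange φ (P.whiskerLeft g (ofGen2 β))).comp
        (P.precomp3
          (P.whiskerLeft f (P.whiskerLeft g (ofGen2 β)))
          (P.whiskerRight3 (ofGen3 A) (g.comp h'))))
  /-- For `α : f ⇒ f'` and `B : ψ ⇛ ψ'` with `ψ, ψ' : h ⇒ h'`, a generator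
  `((α ∘₀ g ∘₀ h) ∘₁ (f' ∘₀ g ∘₀ B)) ∘₂ X_{α ∘₀ g, ψ'}
    ⟶ X_{α ∘₀ g, ψ} ∘₂ ((f ∘₀ g ∘₀ B) ∘₁ (α ∘₀ g ∘₀ h'))`. -/
  naturalityRight : ∀ {x x' y' y : P.gen0}
    {f f' : P.Cell1 x x'} (α : P.gen2 f f') (g : P.Cell1 x' y')
    {h h' : P.Cell1 y' y} {ψ ψ' : P.Cell2 h h'} (B : P.gen3 ψ ψ'),
    P.gen4
      ((P.precomp3
          (P.whiskerRight (P.whiskerRight (ofGen2 α) g) h)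
          (P.whiskerLeft3 (f'.comp g) (ofGen3 B))).comp
        (interchangers.interchange (P.whiskerRight (ofGen2 α) g) ψ'))
      ((interchangers.interchange (P.whiskerRight (ofGen2 α) g) ψ).comp
        (P.postcomp3
          (P.whiskerLeft3 (f.comp g) (ofGen3 B))
          (P.whiskerRight (P.whiskerRight (ofGen2 α) g) h')))

/-- A Gray presentation: a `4`-prepolygraph containing interchange generators, independence
generators and interchange naturality generators. -/
structure GrayPresentation extends Prepolygraph4.{u} where
  gray : GrayGenerators toPrepolygraph4

/-! ### The presented precategory, its localization, and coherence -/

/-- The smallest congruence on the `3`-cells of the free `3`-precategory (an equivalence relation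
compatible with all compositions) that relates the source and the target of every
`4`-generator. -/
inductive Prepolygraph4.Cong (P : Prepolygraph4.{u}) :
    ∀ {x y : P.gen0} {f g : P.Cell1 x y} {φ ψ : P.Cell2 f g},
      P.Cell3 φ ψ → P.Cell3 φ ψ → Prop
  | of {x y : P.gen0} {f g : P.Cell1 x y} {φ ψ : P.Cell2 f g} {F F' : P.Cell3 φ ψ}
      (G : P.gen4 F F') : Cong P F F'
  | refl {x y : P.gen0} {f g : P.Cell1 x y} {φ ψ : P.Cell2 f g} (F : P.Cell3 φ ψ) : Cong P F F
  | symm {x y : P.gen0} {f g : P.Cell1 x y} {φ ψ : P.Cell2 f g} {F F' : P.Cell3 φ ψ} :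
      Cong P F F' → Cong P F' F
  | trans {x y : P.gen0} {f g : P.Cell1 x y} {φ ψ : P.Cell2 f g} {F F' F'' : P.Cell3 φ ψ} :
      Cong P F F' → Cong P F' F'' → Cong P F F''
  | comp {x y : P.gen0} {f g : P.Cell1 x y} {φ ψ χ : P.Cell2 f g} {F F' : P.Cell3 φ ψ}
      {G G' : P.Cell3 ψ χ} : Cong P F F' → Cong P G G' → Cong P (F.comp G) (F'.comp G')
  | whiskerLeft {x y z : P.gen0} {f g : P.Cell1 x y} {φ ψ : P.Cell2 f g} {F F' : P.Cell3 φ ψ}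
      (l : P.Cell1 z x) : Cong P F F' → Cong P (P.whiskerLeft3 l F) (P.whiskerLeft3 l F')
  | whiskerRight {x y z : P.gen0} {f g : P.Cell1 x y} {φ ψ : P.Cell2 f g} {F F' : P.Cell3 φ ψ}
      (r : P.Cell1 y z) : Cong P F F' → Cong P (P.whiskerRight3 F r) (P.whiskerRight3 F' r)
  | precomp {x y : P.gen0} {e f g : P.Cell1 x y} {φ ψ : P.Cell2 f g} {F F' : P.Cell3 φ ψ}
      (lam : P.Cell2 e f) : Cong P F F' → Cong P (P.precomp3 lam F) (P.precomp3 lam F')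
  | postcomp {x y : P.gen0} {f g h : P.Cell1 x y} {φ ψ : P.Cell2 f g} {F F' : P.Cell3 φ ψ}
      (rho : P.Cell2 g h) : Cong P F F' → Cong P (P.postcomp3 F rho) (P.postcomp3 F' rho)

/-- The congruence, as a relation on the morphisms of the category of `2`-cells `f ⇒ g` and
`3`-cells between them. -/
def Prepolygraph4.homRel (P : Prepolygraph4.{u}) {x y : P.gen0} (f g : P.Cell1 x y) :
    HomRel (Paths (P.Cell2 f g)) :=
  fun φ ψ F F' => P.Cong (φ := (φ : P.Cell2 f g)) (ψ := (ψ : P.Cell2 f g)) F F'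

/-- The category of `2`-cells `f ⇒ g` and of `3`-cells between them in the `3`-precategory
presented by a `4`-prepolygraph. -/
abbrev Prepolygraph4.Presented (P : Prepolygraph4.{u}) {x y : P.gen0} (f g : P.Cell1 x y) :
    Type u :=
  CategoryTheory.Quotient (P.homRel f g)

/-- The groupoid of `2`-cells `f ⇒ g` and of `3`-cells between them in the localization at all
`3`-cells of the `3`-precategory presented by a `4`-prepolygraph. This localization has the same
cells in dimension at most two; its `3`-cells are zigzags of `3`-cells, up to the relations of the
free groupoid on a category. -/
abbrev Prepolygraph4.Localized (P : Prepolygraph4.{u}) {x y : P.gen0} (f g : P.Cell1 x y) :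
    Type u :=
  CategoryTheory.FreeGroupoid (P.Presented f g)

/-- A Gray presentation is coherent when any two parallel `3`-cells of the localization of the
presented precategory are equal. -/
def GrayPresentation.Coherent (Q : GrayPresentation.{u}) : Prop :=
  ∀ {x y : Q.gen0} {f g : Q.Cell1 x y} {φ ψ : Q.Localized f g} (F₁ F₂ : φ ⟶ ψ), F₁ = F₂

/-! ### Branchings

A local branching is a pair `S₁ S₂ : RewritingStep P f g` with `S₁.src = S₂.src`. -/

section Branchings

variable {P : Prepolygraph3.{u}} {x y : P.gen0} {f g : P.Cell1 x y}

/-- The local branching `(S₁, S₂)` is minimal: whenever `Sᵢ = lam ∘₁ (l ∘₀ Tᵢ ∘₀ r) ∘₁ rho` for a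
local branching `(T₁, T₂)`, the cells `l`, `r`, `lam` and `rho` are identities, that is, have
length zero. -/
def IsMinimal (S₁ S₂ : RewritingStep P f g) : Prop :=
  ∀ {a b : P.gen0} {s t : P.Cell1 a b} (T₁ T₂ : RewritingStep P s t), T₁.src = T₂.src →
    ∀ (l : P.Cell1 x a) (r : P.Cell1 b y) (lam : P.Cell2 f (l.comp (s.comp r)))
      (rho : P.Cell2 (l.comp (t.comp r)) g),
      S₁ = (((T₁.whiskerRight r).whiskerLeft l).precomp lam).postcomp rho →
      S₂ = (((T₂.whiskerRight r).whiskerLeft l).precomp lam).postcomp rho →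
      l.length = 0 ∧ r.length = 0 ∧ lam.length = 0 ∧ rho.length = 0

/-- The branching consisting of `(l₁ ∘₀ A₁ ∘₀ r₁) ∘₁ χ ∘₁ (l₂ ∘₀ φ₂ ∘₀ r₂)` and
`(l₁ ∘₀ φ₁ ∘₀ r₁) ∘₁ χ ∘₁ (l₂ ∘₀ A₂ ∘₀ r₂)`, where `Aᵢ : φᵢ ⇛ φᵢ'` are `3`-generators. -/
inductive IsIndependent : ∀ {x y : P.gen0} {f g : P.Cell1 x y},
    RewritingStep P f g → RewritingStep P f g → Prop
  | mk {x a₁ b₁ a₂ b₂ y : P.gen0}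
      {s₁ t₁ : P.Cell1 a₁ b₁} {φ₁ φ₁' : P.Cell2 s₁ t₁} (A₁ : P.gen3 φ₁ φ₁')
      {s₂ t₂ : P.Cell1 a₂ b₂} {φ₂ φ₂' : P.Cell2 s₂ t₂} (A₂ : P.gen3 φ₂ φ₂')
      (l₁ : P.Cell1 x a₁) (r₁ : P.Cell1 b₁ y) (l₂ : P.Cell1 x a₂) (r₂ : P.Cell1 b₂ y)
      (χ : P.Cell2 (l₁.comp (t₁.comp r₁)) (l₂.comp (s₂.comp r₂))) :
      IsIndependent
        (RewritingStep.mk A₁ l₁ r₁ Quiver.Path.nil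
          (χ.comp (P.whiskerLeft l₂ (P.whiskerRight φ₂ r₂))))
        (RewritingStep.mk A₂ l₂ r₂ ((P.whiskerLeft l₁ (P.whiskerRight φ₁ r₁)).comp χ)
          Quiver.Path.nil)

/-- For `0`-composable `2`-cells `φ = φ₀ ∘₁ w` and `ψ = v ∘₁ ψ₀`, the rewriting step of source
`(φ ∘₀ h) ∘₁ (f' ∘₀ ψ)` which exchanges the last whisker `w` of `φ` and the first whisker `v`
of `ψ`. -/
def InterchangeGenerators.middleExchange (I : InterchangeGenerators P) {x y z : P.gen0}
    {f m f' : P.Cell1 x y} {h n h' : P.Cell1 y z} (φ₀ : P.Cell2 f m) (w : m ⟶ f')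
    (v : h ⟶ n) (ψ₀ : P.Cell2 n h') : RewritingStep P (f.comp h) (f'.comp h') :=
  ((I.exchange w v).precomp (P.whiskerRight φ₀ h)).postcomp (P.whiskerLeft f' ψ₀)

/-- Natural branchings. In the first case, `S₁ = (A ∘₀ g ∘₀ h) ∘₁ (f' ∘₀ g ∘₀ ψ)` for a
`3`-generator `A : φ ⇛ φ'`, and `S₂` exchanges the last whisker of `φ` and the first whisker of
`g ∘₀ ψ`. In the second case, `S₁ = (φ ∘₀ g ∘₀ h) ∘₁ (f' ∘₀ g ∘₀ B)` for a `3`-generator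
`B : ψ ⇛ ψ'`, and `S₂` exchanges the last whisker of `φ ∘₀ g` and the first whisker of `ψ`. -/
inductive IsNatural (I : InterchangeGenerators P) : ∀ {x y : P.gen0} {f g : P.Cell1 x y},
    RewritingStep P f g → RewritingStep P f g → Prop
  | left {x x' y' y : P.gen0} {f m f' : P.Cell1 x x'} {φ φ' : P.Cell2 f f'} (A : P.gen3 φ φ')
      (g : P.Cell1 x' y') {h h' : P.Cell1 y' y} (ψ : P.Cell2 h h')
      (φ₀ : P.Cell2 f m) (w : m ⟶ f') (hφ : φ = φ₀.cons w)
      {n : P.Cell1 x' y} (v : g.comp h ⟶ n) (ψ₀ : P.Cell2 n (g.comp h'))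
      (hψ : P.whiskerLeft g ψ = v.toPath.comp ψ₀) :
      IsNatural I
        (((stepOfGen3 A).whiskerRight (g.comp h)).postcomp
          (P.whiskerLeft f' (P.whiskerLeft g ψ)))
        (I.middleExchange φ₀ w v ψ₀)
  | right {x x' y' y : P.gen0} {f f' : P.Cell1 x x'} (φ : P.Cell2 f f') (g : P.Cell1 x' y')
      {h n h' : P.Cell1 y' y} {ψ ψ' : P.Cell2 h h'} (B : P.gen3 ψ ψ')
      {m : P.Cell1 x y'} (φ₀ : P.Cell2 (f.comp g) m) (w : m ⟶ f'.comp g)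
      (hφ : P.whiskerRight φ g = φ₀.cons w)
      (v : h ⟶ n) (ψ₀ : P.Cell2 n h') (hψ : ψ = v.toPath.comp ψ₀) :
      IsNatural I
        (((stepOfGen3 B).whiskerLeft (f'.comp g)).precomp
          (P.whiskerRight (P.whiskerRight φ g) h))
        (I.middleExchange φ₀ w v ψ₀)

end Branchings

/-- The critical branchings of a Gray presentation: minimal local branchings `(S₁, S₂)` such that
neither `(S₁, S₂)` nor `(S₂, S₁)` is trivial, independent or natural. -/
structure GrayPresentation.IsCritical (Q : GrayPresentation.{u}) {x y : Q.gen0}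
    {f g : Q.Cell1 x y} (S₁ S₂ : RewritingStep Q.toPrepolygraph3 f g) : Prop where
  src_eq : S₁.src = S₂.src
  minimal : IsMinimal S₁ S₂
  not_trivial : S₁ ≠ S₂
  not_independent : ¬ IsIndependent S₁ S₂
  not_independent_symm : ¬ IsIndependent S₂ S₁
  not_natural : ¬ IsNatural Q.gray.interchangers S₁ S₂
  not_natural_symm : ¬ IsNatural Q.gray.interchangers S₂ S₁

end GrayRewriting

/-!
Coherence is obtained from a form of Newman's lemma due to Squier. Fix parallel `1`-cells and
consider the `2`-cells between them as vertices and the rewriting steps as edges. Suppose that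
rewriting terminates and that any two steps with a common source extend to congruent paths with a
common target. By well-founded induction, any two paths from a `2`-cell to normal forms then have
the same target and are congruent (`map_path_eq_of_locallyConfluent`). The presented category
therefore admits a calculus of left fractions with respect to all its arrows, and every arrow
`φ ⟶ ψ` of its localization is `p ≫ q⁻¹` for paths `p` and `q` from `φ` and `ψ` to a common normal
form. These paths are unique up to congruence, so that parallel arrows are equal
(`FreeGroupoid.hom_ext_of_locallyConfluent`).

It remains to join all local branchings (`GrayPresentation.joinable_of_src_eq`). A branching that
is not minimal arises from one with a smaller context, and congruences pass to contexts. A minimal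
branching is critical, trivial, independent or natural. Critical ones are joined by assumption, and
independent ones by an independence generator. For a natural branching, the first step of one side
of an interchange naturality generator is exactly the exchange in the branching, once the whisker
that is exchanged with the `3`-generator is stripped of its outer context; this context is then put
back (`Joinable.gen3_exchange`, `Joinable.exchange_gen3`).

The associativity and unit laws of `0`-composition do not hold definitionally. To compare rewriting
steps whose boundaries are equal only up to these laws, a step is replaced by an element of
`Whisker3`, which forgets the boundary.
-/

/-! ### Newman's lemma and localization -/

section AbstractRewriting

universe v' u'

/-- If every object of `C` maps to a distinguished object, in such a way that the target and the
arrow are unique, then parallel arrows of the free groupoid on `C` are equal. The hypotheses give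
`C` a calculus of left fractions, so that an arrow of the free groupoid is a fraction `f ≫ g⁻¹`
whose two legs can be taken with distinguished target, which determines them. -/
theorem FreeGroupoid.hom_ext_of_unique_normal {C : Type u'} [Category.{v'} C] (IsNormal : C → Prop)
    (exists_normal : ∀ X, ∃ N, IsNormal N ∧ Nonempty (X ⟶ N))
    (unique_normal : ∀ {X N N' : C} (f : X ⟶ N) (f' : X ⟶ N'), IsNormal N → IsNormal N' →
      ∃ h : N = N', f ≫ eqToHom h = f')
    {X Y : FreeGroupoid C} (m m' : X ⟶ Y) : m = m' := by
  have : (⊤ : MorphismProperty C).HasLeftCalculusOfFractions :=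
    { exists_leftFraction := by
        intro X Y φ
        obtain ⟨N, hN, ⟨p⟩⟩ := exists_normal Y
        obtain ⟨N', hN', ⟨q⟩⟩ := exists_normal X
        obtain ⟨rfl, h⟩ := unique_normal (φ.f ≫ p) (φ.s ≫ q) hN hN'
        exact ⟨⟨q, p, trivial⟩, by simpa using h⟩
      ext := by
        intro X' X Y f₁ f₂ s _ _
        obtain ⟨N, hN, ⟨p⟩⟩ := exists_normal Y
        obtain ⟨_, h⟩ := unique_normal (f₁ ≫ p) (f₂ ≫ p) hN hN
        exact ⟨N, p, trivial, by simpa using h⟩ }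
  obtain ⟨X, rfl⟩ := FreeGroupoid.of_obj_bijective.2 X
  obtain ⟨Y, rfl⟩ := FreeGroupoid.of_obj_bijective.2 Y
  have key : ∀ m : (FreeGroupoid.of C).obj X ⟶ (FreeGroupoid.of C).obj Y,
      ∃ (N : C) (_ : IsNormal N) (f : X ⟶ N) (g : Y ⟶ N),
        m ≫ (FreeGroupoid.of C).map g = (FreeGroupoid.of C).map f := by
    intro m
    obtain ⟨φ, rfl⟩ := Localization.exists_leftFraction (FreeGroupoid.of C) ⊤ m
    obtain ⟨N, hN, ⟨p⟩⟩ := exists_normal φ.Y'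
    refine ⟨N, hN, φ.f ≫ p, φ.s ≫ p, ?_⟩
    simp only [Functor.map_comp, ← Category.assoc]
    rw [MorphismProperty.LeftFraction.map_comp_map_s]
  obtain ⟨N, hN, f, g, h⟩ := key m
  obtain ⟨N', hN', f', g', h'⟩ := key m'
  obtain ⟨rfl, hf⟩ := unique_normal f f' hN hN'
  obtain ⟨_, hg⟩ := unique_normal g g' hN hN'
  simp only [eqToHom_refl, Category.comp_id] at hf hg
  subst hf hg
  rw [← cancel_mono ((FreeGroupoid.of C).map g), h, h']

/-- A vertex of a quiver is normal when no edge leaves it. -/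
def IsNormalVertex {V : Type u'} [Quiver.{v'} V] (N : V) : Prop :=
  ∀ M : V, IsEmpty (N ⟶ M)

theorem exists_path_normalVertex {V : Type u'} [Quiver.{v'} V]
    (wf : WellFounded fun b a : V => Nonempty (a ⟶ b)) (X : V) :
    ∃ N, IsNormalVertex N ∧ Nonempty (Quiver.Path X N) := by
  induction X using wf.induction with
  | _ X ih =>
    by_cases hX : IsNormalVertex X
    · exact ⟨X, hX, ⟨.nil⟩⟩
    · unfold IsNormalVertex at hX
      push Not at hX
      obtain ⟨M, ⟨e⟩⟩ := hX
      obtain ⟨N, hN, ⟨p⟩⟩ := ih M ⟨e⟩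
      exact ⟨N, hN, ⟨e.toPath.comp p⟩⟩

/-- Newman's lemma with coefficients in a category: if the edges of a quiver terminate, and if any
two edges with a common source can be completed to paths that a functor `L` identifies, then `L`
identifies any two paths from a given vertex to normal vertices, which have to coincide. -/
theorem map_path_eq_of_locallyConfluent {V : Type u'} [Quiver.{v'} V] {C : Type*}
    [Category C] (L : Paths V ⥤ C) (wf : WellFounded fun b a : V => Nonempty (a ⟶ b))
    (confl : ∀ {a b₁ b₂ : V} (e₁ : a ⟶ b₁) (e₂ : a ⟶ b₂), ∃ (c : V) (p₁ : Quiver.Path b₁ c)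
      (p₂ : Quiver.Path b₂ c),
      L.map (X := a) (Y := c) (e₁.toPath.comp p₁) = L.map (X := a) (Y := c) (e₂.toPath.comp p₂))
    {a N N' : V} (p : Quiver.Path a N) (p' : Quiver.Path a N')
    (hN : IsNormalVertex N) (hN' : IsNormalVertex N') :
    ∃ h : N = N', L.map (X := a) (Y := N') (p.cast rfl h) = L.map (X := a) (Y := N') p' := by
  induction a using wf.induction generalizing N N' with
  | _ a ih =>
    by_cases hp : p.length = 0
    · obtain rfl := p.eq_of_length_zero hp
      obtain rfl := p.eq_nil_of_length_zero hp
      by_cases hp' : p'.length = 0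
      · obtain rfl := p'.eq_of_length_zero hp'
        obtain rfl := p'.eq_nil_of_length_zero hp'
        exact ⟨rfl, rfl⟩
      · obtain ⟨b, e, _⟩ := (p'.length_ne_zero_iff_eq_comp).1 hp'
        exact (hN _).elim e
    by_cases hp' : p'.length = 0
    · obtain rfl := p'.eq_of_length_zero hp'
      obtain ⟨b, e, _⟩ := (p.length_ne_zero_iff_eq_comp).1 hp
      exact (hN' _).elim e
    obtain ⟨b₁, e₁, q₁, rfl, -⟩ := (p.length_ne_zero_iff_eq_comp).1 hp
    obtain ⟨b₂, e₂, q₂, rfl, -⟩ := (p'.length_ne_zero_iff_eq_comp).1 hp'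
    obtain ⟨c, r₁, r₂, h⟩ := confl e₁ e₂
    obtain ⟨M, hM, ⟨k⟩⟩ := exists_path_normalVertex wf c
    -- All paths are compared with the one that continues the joined edges to a normal vertex.
    obtain ⟨rfl, h₁⟩ := ih b₁ ⟨e₁⟩ q₁ (r₁.comp k) hN hM
    obtain ⟨rfl, h₂⟩ := ih b₂ ⟨e₂⟩ q₂ (r₂.comp k) hN' hM
    refine ⟨rfl, ?_⟩
    have hc : ∀ {x y z : V} (s : Quiver.Path x y) (t : Quiver.Path y z),
      L.map (X := x) (Y := z) (s.comp t) =
        L.map (X := x) (Y := y) s ≫ L.map (X := y) (Y := z) t := fun s t => L.map_comp _ _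
    simp only [Quiver.Path.cast_rfl_rfl, hc] at h h₁ h₂ ⊢
    rw [h₁, h₂, ← Category.assoc, h, Category.assoc]

/-- Squier's homotopical form of Newman's lemma: if the edges of a quiver terminate and local
branchings can be closed up to `r`, then the groupoid presented by the quiver and the relations
`r` has at most one arrow between any two objects. -/
theorem FreeGroupoid.hom_ext_of_locallyConfluent {V : Type u'} [Quiver.{v'} V]
    (r : HomRel (Paths V)) (wf : WellFounded fun b a : V => Nonempty (a ⟶ b))
    (confl : ∀ {a b₁ b₂ : V} (e₁ : a ⟶ b₁) (e₂ : a ⟶ b₂), ∃ (c : V) (p₁ : Quiver.Path b₁ c)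
      (p₂ : Quiver.Path b₂ c), r (X := a) (Y := c) (e₁.toPath.comp p₁) (e₂.toPath.comp p₂))
    {X Y : FreeGroupoid (CategoryTheory.Quotient r)} (m m' : X ⟶ Y) : m = m' := by
  refine FreeGroupoid.hom_ext_of_unique_normal (fun N => IsNormalVertex (V := V) N.as) ?_ ?_ m m'
  · rintro ⟨X⟩
    obtain ⟨N, hN, ⟨p⟩⟩ := exists_path_normalVertex wf X
    exact ⟨⟨N⟩, hN, ⟨(Quotient.functor r).map p⟩⟩
  · rintro ⟨X⟩ ⟨N⟩ ⟨N'⟩ ⟨p⟩ ⟨p'⟩ hN hN'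
    obtain ⟨h : N = N', hp⟩ := map_path_eq_of_locallyConfluent (Quotient.functor r) wf
      (fun e₁ e₂ => by
        obtain ⟨c, p₁, p₂, h⟩ := confl e₁ e₂
        exact ⟨c, p₁, p₂, CategoryTheory.Quotient.sound r h⟩) p p' hN hN'
    subst h
    exact ⟨rfl, (Category.comp_id _).trans hp⟩

end AbstractRewriting

namespace GrayRewriting

open Prepolygraph2 Prepolygraph3

/-! ### Rewriting steps without boundaries -/

theorem length_whiskers {P : Prepolygraph2.{u}} {x y : P.gen0} {f g : P.Cell1 x y}
    (φ : P.Cell2 f g) : (P.whiskers φ).length = φ.length := by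
  induction φ with
  | nil => rfl
  | cons φ e ih => simp [whiskers, ih]

theorem whiskers_toPath {P : Prepolygraph2.{u}} {x y : P.gen0} {f g : P.Cell1 x y} (e : f ⟶ g) :
    P.whiskers e.toPath = [e.1] := rfl

theorem whiskers_whiskerLeft_toPath {P : Prepolygraph2.{u}} {x y z : P.gen0} (l : P.Cell1 z x)
    {f g : P.Cell1 x y} (e : f ⟶ g) :
    P.whiskers (P.whiskerLeft l e.toPath) = [(edgeLeft l e).1] := rfl

theorem whiskers_whiskerRight_toPath {P : Prepolygraph2.{u}} {x y z : P.gen0} {f g : P.Cell1 x y}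
    (e : f ⟶ g) (r : P.Cell1 y z) :
    P.whiskers (P.whiskerRight e.toPath r) = [(edgeRight e r).1] := rfl

/-- A rewriting step whose boundary `1`-cells are forgotten, the `2`-cells before and after the
generator being recorded as their lists of whiskers. Together with its boundary, it determines
the step; unlike the step, it can be compared across equal but distinct boundaries. -/
structure Whisker3 (P : Prepolygraph3.{u}) (x y : P.gen0) where
  {a : P.gen0}
  {b : P.gen0}
  {s : P.Cell1 a b}
  {t : P.Cell1 a b}
  {σ : P.Cell2 s t}
  {τ : P.Cell2 s t}
  gen : P.gen3 σ τ
  left : P.Cell1 x a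
  right : P.Cell1 b y
  before : List (Whisker2 P.toPrepolygraph2 x y)
  after : List (Whisker2 P.toPrepolygraph2 x y)

namespace Whisker3

variable {P : Prepolygraph3.{u}} {x y z : P.gen0}

/-- `l ∘₀ s`. -/
def whiskerLeft (l : P.Cell1 z x) (s : Whisker3 P x y) : Whisker3 P z y :=
  ⟨s.gen, l.comp s.left, s.right, s.before.map (Whisker2.whiskerLeft l),
    s.after.map (Whisker2.whiskerLeft l)⟩

/-- `s ∘₀ r`. -/
def whiskerRight (s : Whisker3 P x y) (r : P.Cell1 y z) : Whisker3 P x z :=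
  ⟨s.gen, s.left, s.right.comp r, s.before.map (fun w => w.whiskerRight r),
    s.after.map (fun w => w.whiskerRight r)⟩

/-- `lam ∘₁ s`. -/
def precomp (lam : List (Whisker2 P.toPrepolygraph2 x y)) (s : Whisker3 P x y) : Whisker3 P x y :=
  ⟨s.gen, s.left, s.right, lam ++ s.before, s.after⟩

/-- `s ∘₁ rho`. -/
def postcomp (s : Whisker3 P x y) (rho : List (Whisker2 P.toPrepolygraph2 x y)) : Whisker3 P x y :=
  ⟨s.gen, s.left, s.right, s.before, s.after ++ rho⟩

/-- The total length of the cells that surround the generator. -/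
def contextSize (s : Whisker3 P x y) : ℕ :=
  s.left.length + s.right.length + s.before.length + s.after.length

theorem precomp_precomp (lam lam' : List (Whisker2 P.toPrepolygraph2 x y)) (s : Whisker3 P x y) :
    (s.precomp lam').precomp lam = s.precomp (lam ++ lam') := by
  simp [precomp]

theorem postcomp_postcomp (s : Whisker3 P x y) (rho rho' : List (Whisker2 P.toPrepolygraph2 x y)) :
    (s.postcomp rho).postcomp rho' = s.postcomp (rho ++ rho') := by
  simp [postcomp]

/-- Congruence for an interchange generator in a context. It is needed because the type of the
generator depends on the `1`-cell `k`, which prevents rewriting `k` in place. -/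
theorem mk_X_congr (I : InterchangeGenerators P) {a b c d : P.gen0} {s t : P.Cell1 a b}
    {s' t' : P.Cell1 c d} (α : P.gen2 s t) {k k' : P.Cell1 b c} (β : P.gen2 s' t')
    {l l' : P.Cell1 x a} {r r' : P.Cell1 d y}
    {lam lam' rho rho' : List (Whisker2 P.toPrepolygraph2 x y)} (hk : k = k') (hl : l = l')
    (hr : r = r') (hlam : lam = lam') (hrho : rho = rho') :
    (⟨I.X α k β, l, r, lam, rho⟩ : Whisker3 P x y) = ⟨I.X α k' β, l', r', lam', rho'⟩ := by
  subst hk hl hr hlam hrho; rfl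

theorem contextSize_whiskerLeft (l : P.Cell1 z x) (s : Whisker3 P x y) :
    (s.whiskerLeft l).contextSize = l.length + s.contextSize := by
  simp [contextSize, whiskerLeft, Quiver.Path.length_comp, add_assoc]

theorem contextSize_whiskerRight (s : Whisker3 P x y) (r : P.Cell1 y z) :
    (s.whiskerRight r).contextSize = s.contextSize + r.length := by
  simp [contextSize, whiskerRight, Quiver.Path.length_comp]; omega

theorem contextSize_precomp (lam : List (Whisker2 P.toPrepolygraph2 x y)) (s : Whisker3 P x y) :
    (s.precomp lam).contextSize = lam.length + s.contextSize := by
  simp [contextSize, precomp]; omega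

theorem contextSize_postcomp (s : Whisker3 P x y) (rho : List (Whisker2 P.toPrepolygraph2 x y)) :
    (s.postcomp rho).contextSize = s.contextSize + rho.length := by
  simp [contextSize, postcomp, add_assoc]

end Whisker3

section Steps

variable {P : Prepolygraph3.{u}} {x y z : P.gen0} {f g : P.Cell1 x y}

/-- The rewriting step, without its boundary. -/
def RewritingStep.toWhisker3 (S : RewritingStep P f g) : Whisker3 P x y :=
  ⟨S.gen, S.left, S.right, P.whiskers S.before, P.whiskers S.after⟩

namespace RewritingStep

theorem toWhisker3_injective {S T : RewritingStep P f g} (h : S.toWhisker3 = T.toWhisker3) :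
    S = T := by
  cases S; cases T
  simp only [toWhisker3, Whisker3.mk.injEq] at h
  obtain ⟨rfl, rfl, h⟩ := h
  simp only [heq_eq_eq] at h
  obtain ⟨rfl, rfl, h⟩ := h
  simp only [heq_eq_eq] at h
  obtain ⟨rfl, rfl, h⟩ := h
  simp only [heq_eq_eq] at h
  obtain ⟨rfl, rfl, rfl, hb, ha⟩ := h
  rw [whiskers_injective hb, whiskers_injective ha]

theorem toWhisker3_whiskerLeft (l : P.Cell1 z x) (S : RewritingStep P f g) :
    (S.whiskerLeft l).toWhisker3 = S.toWhisker3.whiskerLeft l := by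
  simp [toWhisker3, whiskerLeft, Whisker3.whiskerLeft, whiskers_cast, whiskers_whiskerLeft]

theorem toWhisker3_whiskerRight (S : RewritingStep P f g) (r : P.Cell1 y z) :
    (S.whiskerRight r).toWhisker3 = S.toWhisker3.whiskerRight r := by
  simp [toWhisker3, whiskerRight, Whisker3.whiskerRight, whiskers_cast, whiskers_whiskerRight]

theorem toWhisker3_precomp {e : P.Cell1 x y} (lam : P.Cell2 e f) (S : RewritingStep P f g) :
    (S.precomp lam).toWhisker3 = S.toWhisker3.precomp (P.whiskers lam) := by
  simp [toWhisker3, precomp, Whisker3.precomp, whiskers_comp]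

theorem toWhisker3_postcomp (S : RewritingStep P f g) {h : P.Cell1 x y} (rho : P.Cell2 g h) :
    (S.postcomp rho).toWhisker3 = S.toWhisker3.postcomp (P.whiskers rho) := by
  simp [toWhisker3, postcomp, Whisker3.postcomp, whiskers_comp]

end RewritingStep

open RewritingStep

theorem toWhisker3_stepOfGen3 {φ ψ : P.Cell2 f g} (A : P.gen3 φ ψ) :
    (stepOfGen3 A).toWhisker3 = ⟨A, Quiver.Path.nil, Quiver.Path.nil, [], []⟩ := by
  simp only [toWhisker3, stepOfGen3, whiskers_cast]; rfl

theorem toWhisker3_exchange (I : InterchangeGenerators P) {f f' : P.Cell1 x y} {h h' : P.Cell1 y z}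
    (w : f ⟶ f') (v : h ⟶ h') :
    (I.exchange w v).toWhisker3 =
      ⟨I.X w.1.gen (w.1.right.comp v.1.left) v.1.gen, w.1.left, v.1.right, [], []⟩ := by
  simp only [toWhisker3, InterchangeGenerators.exchange, whiskers_cast]; rfl

/-- The list of rewriting steps of a `3`-cell, without their boundaries. -/
def steps {φ : P.Cell2 f g} : ∀ {ψ : P.Cell2 f g}, P.Cell3 φ ψ → List (Whisker3 P x y)
  | _, Quiver.Path.nil => []
  | _, Quiver.Path.cons F S => steps F ++ [S.1.toWhisker3]

theorem steps_toPath {φ ψ : P.Cell2 f g} (S : φ ⟶ ψ) :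
    steps (P := P) S.toPath = [S.1.toWhisker3] := rfl

theorem steps_comp {φ ψ χ : P.Cell2 f g} (F : P.Cell3 φ ψ) (G : P.Cell3 ψ χ) :
    steps (F.comp G) = steps F ++ steps G := by
  induction G with
  | nil => simp [steps]
  | cons G S ih => simp [steps, ih]

theorem steps_cast {φ ψ φ' ψ' : P.Cell2 f g} (hφ : φ = φ') (hψ : ψ = ψ') (F : P.Cell3 φ ψ) :
    steps (F.cast hφ hψ) = steps F := by
  subst hφ hψ; rfl

theorem steps_whiskerLeft3 (l : P.Cell1 z x) {φ ψ : P.Cell2 f g} (F : P.Cell3 φ ψ) :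
    steps (P.whiskerLeft3 l F) = (steps F).map (Whisker3.whiskerLeft l) := by
  induction F with
  | nil => rfl
  | cons F S ih => simp [steps, whiskerLeft3, ih, toWhisker3_whiskerLeft]

theorem steps_whiskerRight3 {φ ψ : P.Cell2 f g} (F : P.Cell3 φ ψ) (r : P.Cell1 y z) :
    steps (P.whiskerRight3 F r) = (steps F).map (fun s => s.whiskerRight r) := by
  induction F with
  | nil => rfl
  | cons F S ih => simp [steps, whiskerRight3, ih, toWhisker3_whiskerRight]

theorem steps_precomp3 {e : P.Cell1 x y} (lam : P.Cell2 e f) {φ ψ : P.Cell2 f g}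
    (F : P.Cell3 φ ψ) :
    steps (P.precomp3 lam F) = (steps F).map (Whisker3.precomp (P.whiskers lam)) := by
  induction F with
  | nil => rfl
  | cons F S ih => simp [steps, precomp3, ih, toWhisker3_precomp]

theorem steps_postcomp3 {φ ψ : P.Cell2 f g} (F : P.Cell3 φ ψ) {h : P.Cell1 x y}
    (rho : P.Cell2 g h) :
    steps (P.postcomp3 F rho) = (steps F).map (fun s => s.postcomp (P.whiskers rho)) := by
  induction F with
  | nil => rfl
  | cons F S ih => simp [steps, postcomp3, ih, toWhisker3_postcomp]

theorem steps_ofGen3 {φ ψ : P.Cell2 f g} (A : P.gen3 φ ψ) :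
    steps (ofGen3 A) = [⟨A, Quiver.Path.nil, Quiver.Path.nil, [], []⟩] :=
  congrArg (fun s => [s]) (toWhisker3_stepOfGen3 A)

theorem exists_eq_toPath_comp_of_head?_steps {φ ψ : P.Cell2 f g} {F : P.Cell3 φ ψ}
    {s : Whisker3 P x y} (h : (steps F).head? = some s) :
    ∃ (φ' : P.Cell2 f g) (S : φ ⟶ φ') (G : P.Cell3 φ' ψ),
      F = S.toPath.comp G ∧ S.1.toWhisker3 = s := by
  have hF : F.length ≠ 0 := by
    intro h0
    obtain rfl := F.eq_of_length_zero h0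
    obtain rfl := F.eq_nil_of_length_zero h0
    simp [steps] at h
  obtain ⟨φ', S, G, rfl, -⟩ := F.length_ne_zero_iff_eq_comp.1 hF
  rw [steps_comp, steps_toPath] at h
  exact ⟨φ', S, G, rfl, Option.some.inj h⟩

theorem steps_interchangeWhisker_nil (I : InterchangeGenerators P) {f f' : P.Cell1 x y}
    (w : f ⟶ f') (h : P.Cell1 y z) :
    steps (I.interchangeWhisker w (Quiver.Path.nil : P.Cell2 h h)) = [] :=
  steps_cast _ _ _

theorem steps_interchangeWhisker_cons (I : InterchangeGenerators P) {f f' : P.Cell1 x y}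
    (w : f ⟶ f') {h n h' : P.Cell1 y z} (ψ : P.Cell2 h n) (v : n ⟶ h') :
    steps (I.interchangeWhisker w (ψ.cons v)) =
      (steps (I.interchangeWhisker w ψ)).map
          (fun s => s.postcomp (P.whiskers (P.whiskerLeft f' v.toPath))) ++
        [(I.exchange w v).toWhisker3.precomp (P.whiskers (P.whiskerLeft f ψ))] :=
  (steps_comp _ _).trans (congrArg₂ _ (steps_postcomp3 _ _) (steps_precomp3 _ _))

/-- The `3`-cell `X_{w,ψ}` begins by exchanging `w` with the first whisker of `ψ`. -/
theorem head?_steps_interchangeWhisker (I : InterchangeGenerators P) {f f' : P.Cell1 x y}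
    (w : f ⟶ f') {h n h' : P.Cell1 y z} (v : h ⟶ n) (ψ₀ : P.Cell2 n h') :
    (steps (I.interchangeWhisker w (v.toPath.comp ψ₀))).head? =
      some ((I.exchange w v).toWhisker3.postcomp (P.whiskers (P.whiskerLeft f' ψ₀))) := by
  induction ψ₀ with
  | nil =>
    refine (congrArg List.head? (steps_interchangeWhisker_cons I w .nil v)).trans ?_
    rw [steps_interchangeWhisker_nil]
    simp [Whisker3.postcomp, Whisker3.precomp, toWhisker3, whiskers, Prepolygraph2.whiskerLeft]
  | cons ψ₀ e ih =>
    rw [Quiver.Path.comp_cons, steps_interchangeWhisker_cons, List.head?_append, List.head?_map,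
      ih]
    simp [Whisker3.postcomp, Prepolygraph2.whiskerLeft, whiskers, whiskers_whiskerLeft_toPath]

theorem steps_interchange_cons (I : InterchangeGenerators P) {f m f' : P.Cell1 x y}
    (φ₀ : P.Cell2 f m) (w : m ⟶ f') {h h' : P.Cell1 y z} (ψ : P.Cell2 h h') :
    steps (I.interchange (φ₀.cons w) ψ) =
      (steps (I.interchangeWhisker w ψ)).map (Whisker3.precomp (P.whiskers (P.whiskerRight φ₀ h)))
        ++ (steps (I.interchange φ₀ ψ)).map
          (fun s => s.postcomp (P.whiskers (P.whiskerRight w.toPath h'))) :=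
  (steps_comp _ _).trans (congrArg₂ _ ((steps_cast _ _ _).trans (steps_precomp3 _ _))
    (steps_postcomp3 _ _))

end Steps

/-! ### Joinable rewriting steps -/

/-- Two rewriting steps are joinable when they are the first steps of two congruent `3`-cells, these
being cells between `2`-cells `f ⇒ g`. The steps are given without their boundaries, so that composites of cells that are equal but not
definitionally so need no transport. -/
def Joinable (P : Prepolygraph4.{u}) {x y : P.gen0} (f g : P.Cell1 x y)
    (s₁ s₂ : Whisker3 P.toPrepolygraph3 x y) : Prop :=
  ∃ (φ ψ : P.Cell2 f g) (F₁ F₂ : P.Cell3 φ ψ),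
    P.Cong F₁ F₂ ∧ (steps F₁).head? = some s₁ ∧ (steps F₂).head? = some s₂

namespace Joinable

variable {P : Prepolygraph4.{u}} {x y z : P.gen0} {f g : P.Cell1 x y}
  {s₁ s₂ : Whisker3 P.toPrepolygraph3 x y}

theorem symm (h : Joinable P f g s₁ s₂) : Joinable P f g s₂ s₁ := by
  obtain ⟨φ, ψ, F₁, F₂, h, h₁, h₂⟩ := h
  exact ⟨φ, ψ, F₂, F₁, h.symm, h₂, h₁⟩

theorem refl (S : RewritingStep P.toPrepolygraph3 f g) :
    Joinable P f g S.toWhisker3 S.toWhisker3 :=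
  ⟨_, _, S.toCell3, S.toCell3, .refl _, rfl, rfl⟩

theorem cast {f' g' : P.Cell1 x y} {t₁ t₂ : Whisker3 P.toPrepolygraph3 x y}
    (h : Joinable P f' g' t₁ t₂) (hf : f' = f) (hg : g' = g) (h₁ : t₁ = s₁) (h₂ : t₂ = s₂) :
    Joinable P f g s₁ s₂ := by
  subst hf hg h₁ h₂; exact h

theorem of_gen4 {φ ψ : P.Cell2 f g} {F₁ F₂ : P.Cell3 φ ψ} (G : P.gen4 F₁ F₂)
    (h₁ : (steps F₁).head? = some s₁) (h₂ : (steps F₂).head? = some s₂) :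
    Joinable P f g s₁ s₂ :=
  ⟨_, _, F₁, F₂, .of G, h₁, h₂⟩

theorem whiskerLeft (h : Joinable P f g s₁ s₂) (l : P.Cell1 z x) :
    Joinable P (l.comp f) (l.comp g) (s₁.whiskerLeft l) (s₂.whiskerLeft l) := by
  obtain ⟨φ, ψ, F₁, F₂, h, h₁, h₂⟩ := h
  exact ⟨_, _, _, _, h.whiskerLeft l, by rw [steps_whiskerLeft3, List.head?_map, h₁]; rfl,
    by rw [steps_whiskerLeft3, List.head?_map, h₂]; rfl⟩

theorem whiskerRight (h : Joinable P f g s₁ s₂) (r : P.Cell1 y z) :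
    Joinable P (f.comp r) (g.comp r) (s₁.whiskerRight r) (s₂.whiskerRight r) := by
  obtain ⟨φ, ψ, F₁, F₂, h, h₁, h₂⟩ := h
  exact ⟨_, _, _, _, h.whiskerRight r, by rw [steps_whiskerRight3, List.head?_map, h₁]; rfl,
    by rw [steps_whiskerRight3, List.head?_map, h₂]; rfl⟩

theorem precomp (h : Joinable P f g s₁ s₂) {e : P.Cell1 x y} (lam : P.Cell2 e f) :
    Joinable P e g (s₁.precomp (P.whiskers lam)) (s₂.precomp (P.whiskers lam)) := by
  obtain ⟨φ, ψ, F₁, F₂, h, h₁, h₂⟩ := h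
  exact ⟨_, _, _, _, h.precomp lam, by rw [steps_precomp3, List.head?_map, h₁]; rfl,
    by rw [steps_precomp3, List.head?_map, h₂]; rfl⟩

theorem postcomp (h : Joinable P f g s₁ s₂) {k : P.Cell1 x y} (rho : P.Cell2 g k) :
    Joinable P f k (s₁.postcomp (P.whiskers rho)) (s₂.postcomp (P.whiskers rho)) := by
  obtain ⟨φ, ψ, F₁, F₂, h, h₁, h₂⟩ := h
  exact ⟨_, _, _, _, h.postcomp rho, by rw [steps_postcomp3, List.head?_map, h₁]; rfl,
    by rw [steps_postcomp3, List.head?_map, h₂]; rfl⟩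

/-- The first steps of the two congruent `3`-cells are `S₁` and `S₂` themselves, because a step is
determined by its boundary and the underlying element of `Whisker3`. -/
theorem exists_cong {φ φ₁ φ₂ : P.Cell2 f g} (S₁ : φ ⟶ φ₁) (S₂ : φ ⟶ φ₂)
    (h : Joinable P f g S₁.1.toWhisker3 S₂.1.toWhisker3) :
    ∃ (ψ : P.Cell2 f g) (F₁ : P.Cell3 φ₁ ψ) (F₂ : P.Cell3 φ₂ ψ),
      P.Cong (S₁.toPath.comp F₁) (S₂.toPath.comp F₂) := by
  obtain ⟨φ', ψ, F₁, F₂, h, h₁, h₂⟩ := h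
  obtain ⟨χ₁, T₁, G₁, rfl, e₁⟩ := exists_eq_toPath_comp_of_head?_steps h₁
  obtain ⟨χ₂, T₂, G₂, rfl, e₂⟩ := exists_eq_toPath_comp_of_head?_steps h₂
  obtain ⟨S₁, rfl, rfl⟩ := S₁
  obtain ⟨S₂, hS, rfl⟩ := S₂
  obtain ⟨T₁, rfl, rfl⟩ := T₁
  obtain ⟨T₂, hT, rfl⟩ := T₂
  obtain rfl := RewritingStep.toWhisker3_injective e₁
  obtain rfl := RewritingStep.toWhisker3_injective e₂
  exact ⟨ψ, G₁, G₂, h⟩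

theorem of_isIndependent (G : GrayGenerators P)
    {S₁ S₂ : RewritingStep P.toPrepolygraph3 f g} (h : IsIndependent S₁ S₂) :
    Joinable P f g S₁.toWhisker3 S₂.toWhisker3 := by
  obtain ⟨A₁, A₂, l₁, r₁, l₂, r₂, χ⟩ := h
  refine of_gen4 (G.independence A₁ A₂ l₁ r₁ l₂ r₂ χ) ?_ ?_
  · rw [steps_comp, steps_postcomp3, steps_whiskerLeft3, steps_whiskerRight3, steps_ofGen3]
    simp [Whisker3.postcomp, Whisker3.whiskerLeft, Whisker3.whiskerRight,
      RewritingStep.toWhisker3, whiskers]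
  · rw [steps_comp, steps_precomp3, steps_precomp3, steps_whiskerLeft3, steps_whiskerRight3,
      steps_ofGen3]
    simp [Whisker3.precomp, Whisker3.whiskerLeft, Whisker3.whiskerRight,
      RewritingStep.toWhisker3, whiskers, whiskers_comp]

/-- A generator `A` applied before a whisker `v = g ∘₀ β ∘₀ r` is joinable with the exchange of `v`
and the last whisker of the source of `A`, by the naturality generator of `A`, `g` and `β` in the
context `r`. -/
theorem gen3_exchange (G : GrayGenerators P) {f m f' : P.Cell1 x y} (φ₀ : P.Cell2 f m)
    (w : m ⟶ f') {φ' : P.Cell2 f f'} (A : P.gen3 (φ₀.cons w) φ') {h n : P.Cell1 y z} (v : h ⟶ n) :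
    Joinable P (f.comp h) (f'.comp n)
      (((stepOfGen3 A).whiskerRight h).postcomp (P.whiskerLeft f' v.toPath)).toWhisker3
      ((G.interchangers.exchange w v).precomp (P.whiskerRight φ₀ h)).toWhisker3 := by
  obtain ⟨@⟨a, b, s, t, g, β, r⟩, rfl, rfl⟩ := v
  let β' : s ⟶ t := ⟨⟨Quiver.Path.nil, β, Quiver.Path.nil⟩, by simp [Whisker2.src],
    by simp [Whisker2.tgt]⟩
  have key : Joinable P (f.comp (g.comp s)) (f'.comp (g.comp t))
      (((stepOfGen3 A).whiskerRight (g.comp s)).postcomp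
        (P.whiskerLeft f' (P.whiskerLeft g β'.toPath))).toWhisker3
      ((G.interchangers.exchange w (edgeLeft g β')).precomp
        (P.whiskerRight φ₀ (g.comp s))).toWhisker3 := by
    refine of_gen4 (G.naturalityLeft A g β) ?_ ?_
    · rw [steps_comp, steps_postcomp3, steps_whiskerRight3, steps_ofGen3,
        RewritingStep.toWhisker3_postcomp, RewritingStep.toWhisker3_whiskerRight,
        toWhisker3_stepOfGen3]
      rfl
    · rw [steps_comp, steps_interchange_cons, List.append_assoc, List.head?_append, List.head?_map,
        RewritingStep.toWhisker3_precomp]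
      erw [head?_steps_interchangeWhisker G.interchangers w (edgeLeft g β') .nil]
      simp [Whisker3.postcomp, Prepolygraph2.whiskerLeft, whiskers]
  refine (key.whiskerRight r).cast ?_ ?_ ?_ ?_
  · simp [Whisker2.src]
  · simp [Whisker2.tgt]
  · rw [RewritingStep.toWhisker3_postcomp, RewritingStep.toWhisker3_whiskerRight,
      RewritingStep.toWhisker3_postcomp, RewritingStep.toWhisker3_whiskerRight,
      toWhisker3_stepOfGen3, whiskers_whiskerLeft, whiskers_whiskerLeft_toPath,
      whiskers_whiskerLeft_toPath]
    simp [Whisker3.whiskerRight, Whisker3.postcomp, β', edgeLeft, Whisker2.whiskerLeft,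
      Whisker2.whiskerRight, Whisker2.src]
  · rw [RewritingStep.toWhisker3_precomp, RewritingStep.toWhisker3_precomp, toWhisker3_exchange,
      toWhisker3_exchange]
    refine Whisker3.mk_X_congr _ _ _ rfl rfl (Quiver.Path.nil_comp _) ?_ rfl
    simp [Whisker3.precomp, whiskers_whiskerRight, Whisker2.whiskerRight, Whisker2.src]

/-- A generator `B` applied after a whisker `w = l ∘₀ α ∘₀ g` is joinable with the exchange of `w`
and the first whisker of the source of `B`, by the naturality generator of `α`, `g` and `B` in the
context `l`. -/
theorem exchange_gen3 (G : GrayGenerators P) {m f : P.Cell1 x y} (w : m ⟶ f)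
    {h n h' : P.Cell1 y z} (v : h ⟶ n) (ψ₀ : P.Cell2 n h') {ψ' : P.Cell2 h h'}
    (B : P.gen3 (v.toPath.comp ψ₀) ψ') :
    Joinable P (m.comp h) (f.comp h')
      (((stepOfGen3 B).whiskerLeft f).precomp (P.whiskerRight w.toPath h)).toWhisker3
      ((G.interchangers.exchange w v).postcomp (P.whiskerLeft f ψ₀)).toWhisker3 := by
  obtain ⟨@⟨a, b, s, t, l, α, g⟩, rfl, rfl⟩ := w
  let α' : s ⟶ t := ⟨⟨Quiver.Path.nil, α, Quiver.Path.nil⟩, by simp [Whisker2.src],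
    by simp [Whisker2.tgt]⟩
  have key : Joinable P ((s.comp g).comp h) ((t.comp g).comp h')
      (((stepOfGen3 B).whiskerLeft (t.comp g)).precomp
        (P.whiskerRight (P.whiskerRight α'.toPath g) h)).toWhisker3
      ((G.interchangers.exchange (edgeRight α' g) v).postcomp
        (P.whiskerLeft (t.comp g) ψ₀)).toWhisker3 := by
    refine of_gen4 (G.naturalityRight α g B) ?_ ?_
    · rw [steps_comp, steps_precomp3, steps_whiskerLeft3, steps_ofGen3,
        RewritingStep.toWhisker3_precomp, RewritingStep.toWhisker3_whiskerLeft,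
        toWhisker3_stepOfGen3]
      rfl
    · rw [steps_comp, List.head?_append]
      erw [steps_interchange_cons G.interchangers .nil (edgeRight α' g)]
      rw [List.head?_append, List.head?_map, head?_steps_interchangeWhisker,
        RewritingStep.toWhisker3_postcomp]
      rfl
  refine (key.whiskerLeft l).cast ?_ ?_ ?_ ?_
  · simp [Whisker2.src]
  · simp [Whisker2.tgt]
  · rw [RewritingStep.toWhisker3_precomp, RewritingStep.toWhisker3_whiskerLeft,
      RewritingStep.toWhisker3_precomp, RewritingStep.toWhisker3_whiskerLeft,
      toWhisker3_stepOfGen3, whiskers_whiskerRight, whiskers_whiskerRight_toPath,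
      whiskers_whiskerRight_toPath]
    simp [Whisker3.whiskerLeft, Whisker3.precomp, α', edgeRight, Whisker2.whiskerLeft,
      Whisker2.whiskerRight, Whisker2.tgt]
  · rw [RewritingStep.toWhisker3_postcomp, RewritingStep.toWhisker3_postcomp, toWhisker3_exchange,
      toWhisker3_exchange]
    refine Whisker3.mk_X_congr _ _ _
      (congrArg (Quiver.Path.comp · v.1.left) (Quiver.Path.nil_comp g)) rfl rfl rfl ?_
    simp [Whisker3.postcomp, whiskers_whiskerLeft, Whisker2.whiskerLeft, Whisker2.tgt,
      List.map_inj_left]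

theorem of_isNatural (G : GrayGenerators P)
    {S₁ S₂ : RewritingStep P.toPrepolygraph3 f g} (h : IsNatural G.interchangers S₁ S₂) :
    Joinable P f g S₁.toWhisker3 S₂.toWhisker3 := by
  cases h with
  | left A g ψ φ₀ w hφ v ψ₀ hψ =>
    subst hφ
    refine ((gen3_exchange G φ₀ w A v).postcomp (P.whiskerLeft _ ψ₀)).cast rfl rfl ?_ ?_
    · rw [RewritingStep.toWhisker3_postcomp, RewritingStep.toWhisker3_postcomp,
        Whisker3.postcomp_postcomp, hψ]
      simp [whiskers_comp, whiskers_whiskerLeft]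
    · exact (RewritingStep.toWhisker3_postcomp _ _).symm
  | right φ g B φ₀ w hφ v ψ₀ hψ =>
    subst hψ
    refine ((exchange_gen3 G w v ψ₀ B).precomp (P.whiskerRight φ₀ _)).cast rfl rfl ?_ ?_
    · rw [RewritingStep.toWhisker3_precomp, RewritingStep.toWhisker3_precomp,
        Whisker3.precomp_precomp, hφ]
      simp [whiskers, whiskers_toPath, whiskers_whiskerRight]
    · exact (RewritingStep.toWhisker3_precomp _ _).symm

end Joinable

/-! ### Local confluence and coherence -/

/-- If critical branchings are joinable, so are all local branchings: one that is not minimal is a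
branching with a smaller context placed in a context, and a minimal one that is not critical is
trivial, independent or natural. -/
theorem GrayPresentation.joinable_of_src_eq (Q : GrayPresentation.{u})
    (hcrit : ∀ {x y : Q.gen0} {f g : Q.Cell1 x y} {S₁ S₂ : RewritingStep Q.toPrepolygraph3 f g},
      Q.IsCritical S₁ S₂ → Joinable Q.toPrepolygraph4 f g S₁.toWhisker3 S₂.toWhisker3)
    {x y : Q.gen0} {f g : Q.Cell1 x y} (S₁ S₂ : RewritingStep Q.toPrepolygraph3 f g)
    (h : S₁.src = S₂.src) : Joinable Q.toPrepolygraph4 f g S₁.toWhisker3 S₂.toWhisker3 := by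
  induction hn : S₁.toWhisker3.contextSize using Nat.strong_induction_on generalizing x y f g with
  | _ n ih =>
    by_cases hm : IsMinimal S₁ S₂
    · by_cases hc : Q.IsCritical S₁ S₂
      · exact hcrit hc
      · by_contra hj
        refine hc ⟨h, hm, ?_, fun h => hj (.of_isIndependent Q.gray h),
          fun h => hj (Joinable.of_isIndependent Q.gray h).symm,
          fun h => hj (.of_isNatural Q.gray h), fun h => hj (Joinable.of_isNatural Q.gray h).symm⟩
        rintro rfl
        exact hj (.refl _)
    · unfold IsMinimal at hm
      push Not at hm
      obtain ⟨a, b, s, t, T₁, T₂, hT, l, r, lam, rho, rfl, rfl, hlen⟩ := hm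
      have hlt : T₁.toWhisker3.contextSize < n := by
        rw [← hn]
        simp only [RewritingStep.toWhisker3_postcomp, RewritingStep.toWhisker3_precomp,
          RewritingStep.toWhisker3_whiskerLeft, RewritingStep.toWhisker3_whiskerRight,
          Whisker3.contextSize_postcomp, Whisker3.contextSize_precomp,
          Whisker3.contextSize_whiskerLeft, Whisker3.contextSize_whiskerRight, length_whiskers]
        by_contra hle
        exact hlen (by omega) (by omega) (by omega) (by omega)
      simp only [RewritingStep.toWhisker3_postcomp, RewritingStep.toWhisker3_precomp,
        RewritingStep.toWhisker3_whiskerLeft, RewritingStep.toWhisker3_whiskerRight]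
      exact ((((ih _ hlt T₁ T₂ hT rfl).whiskerRight r).whiskerLeft l).precomp lam).postcomp rho

theorem Prepolygraph3.Terminating.wellFounded {P : Prepolygraph3.{u}} (h : P.Terminating)
    {x y : P.gen0} (f g : P.Cell1 x y) :
    WellFounded fun ψ φ : P.Cell2 f g => Nonempty (φ ⟶ ψ) := by
  rw [wellFounded_iff_isEmpty_descending_chain]
  refine ⟨fun ⟨φ, hφ⟩ => ?_⟩
  let S := fun n => (hφ n).some
  exact h (fun n => (S n).1) fun n => (S n).2.2.trans (S (n + 1)).2.1.symm

end GrayRewriting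

open GrayRewriting in
theorem mainTheorem2 (Q : GrayRewriting.GrayPresentation.{u})
    (hterm : Q.Terminating)
    (hcrit : ∀ {x y : Q.gen0} {f g : Q.Cell1 x y} {φ φ₁ φ₂ : Q.Cell2 f g}
      (S₁ : φ ⟶ φ₁) (S₂ : φ ⟶ φ₂), Q.IsCritical S₁.1 S₂.1 →
      ∃ (ψ : Q.Cell2 f g) (F₁ : Q.Cell3 φ₁ ψ) (F₂ : Q.Cell3 φ₂ ψ),
        Nonempty (Q.gen4 (S₁.toPath.comp F₁) (S₂.toPath.comp F₂))) :
    Q.Coherent := by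
  intro x y f g φ ψ F₁ F₂
  refine FreeGroupoid.hom_ext_of_locallyConfluent (Q.homRel f g) (hterm.wellFounded f g)
    (fun S₁ S₂ => Joinable.exists_cong S₁ S₂ ?_) F₁ F₂
  refine Q.joinable_of_src_eq (fun {_ _ _ _ S₁ S₂} hS => ?_) S₁.1 S₂.1 (S₁.2.1.trans S₂.2.1.symm)
  obtain ⟨_, F₁, F₂, ⟨G⟩⟩ := hcrit ⟨S₁, rfl, rfl⟩ ⟨S₂, hS.src_eq.symm, rfl⟩ hS
  refine .of_gen4 G ?_ ?_ <;> rw [steps_comp] <;> rfl
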